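/- Let $H$ be a complex Hilbert space (of any dimension, possibly $0$), with inner product linear in the first variable, and let $\hat\otimes_2$ denote the Hilbertian tensor product (the completion of the algebraic tensor product for $\langle x\otimes y,x'\otimes y'\rangle=\langle x,x'\rangle\langle y,y'\rangle$), with its unitary associativity constraint $\alpha\colon (H\hat\otimes_2H)\hat\otimes_2H\to H\hat\otimes_2(H\hat\otimes_2H)$. A *structure of commutative Hilbertian Frobenius semigroup* on $H$ is a bounded linear map $\mu\colon H\hat\otimes_2H\to H$ that is commutative, associative, and satisfies $$\mu^\dagger\mu=(\mathrm{id}\hat\otimes_2\mu)\,\alpha\,(\mu^\dagger\hat\otimes_2\mathrm{id})=(\mu\hat\otimes_2\mathrm{id})\,\alpha^{-1}\,(\mathrm{id}\hat\otimes_2\mu^\dagger),$$ where $\mu^\dagger$, the Hilbert space adjoint of $\mu$, is the comultiplication. It is *special* if $\mu\mu^\dagger=\mathrm{id}_H$; it is *semisimple* (resp. *radical*) if the Jacobson radical of the algebra $(H,\ xy:=\mu(x\otimes y))$, i.e. the intersection of its maximal modular ideals ($H$ itself if there are none), is $0$ (resp. $H$). A bounded linear map $f$ is a *partial isometry* if $ff^\dagger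 f=f$. The set of *group-like elements* of $\mu$ is $G(\mu):=\{x\in H\setminus\{0\}:\mu^\dagger(x)=x\otimes x\}$. An *orthogonal set* of $H$ is a set of pairwise orthogonal non-zero vectors; it is an *orthonormal set* if moreover all its elements have norm $1$. An *orthogonal* (resp. *orthonormal*) *basis* is an orthogonal (resp. orthonormal) set $X$ with $X^\perp=0$. A set $X\subseteq H$ is *bounded above* if there is $C>0$ with $\|x\|\le C$ for all $x\in X$. Then the assignment $\mu\mapsto G(\mu)$ restricts to bijections 1. from the structures of commutative Hilbertian Frobenius semigroups on $H$ with $\mu\ne0$ onto the non-empty bounded above orthogonal sets of $H$; 2. from the structures of semisimple commutative Hilbertian Frobenius semigroups on $H$ onto the bounded above orthogonal bases of $H$; 3. from the structures of commutative Hilbertian Frobenius semigroups on $H$ whose comultiplication $\mu^\dagger$ is a non-zero partial isometry onto the non-empty orthonormal sets of $H$; 4. from the structures of commutative special Hilbertian Frobenius semigroups on $H$ onto the orthonormal bases of $H$; moreover any two such structures $\mu,\nu$ are unitarily isomorphic: there is a unitary $U\colon H\to H$ with $U\mu=\nu(U\hat\otimes_2U)$. 5. The zero multiplication is the unique structure of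 radical commutative Hilbertian Frobenius semigroup on $H$, and it corresponds to the empty orthogonal set: a structure of commutative Hilbertian Frobenius semigroup $\mu$ satisfies $G(\mu)=\emptyset$ if and only if $\mu=0$. The inverse of these bijections sends $X=G(\mu)$ to the structure given, for $u,v\in H$, by the unconditionally convergent sum $$\mu(u\otimes v)=\sum_{x\in X}\frac{\langle u,x\rangle\langle v,x\rangle}{\|x\|^2}\,x .$$ -/

import Mathlib

open scoped TensorProduct

namespace HilbFrob

noncomputable section

variable {H K L M : Type*}
  [NormedAddCommGroup H] [InnerProductSpace ℂ H]
  [NormedAddCommGroup K] [InnerProductSpace ℂ K]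
  [NormedAddCommGroup L] [InnerProductSpace ℂ L]
  [NormedAddCommGroup M] [InnerProductSpace ℂ M]

/-! ### The Hilbert space tensor product -/

/-- The Hilbertian tensor product: the completion of the algebraic tensor product for the inner
product determined by `⟪x ⊗ y, x' ⊗ y'⟫ = ⟪x, x'⟫ ⟪y, y'⟫`. -/
abbrev HTensor (H K : Type*) [NormedAddCommGroup H] [InnerProductSpace ℂ H]
    [NormedAddCommGroup K] [InnerProductSpace ℂ K] : Type _ :=
  UniformSpace.Completion (H ⊗[ℂ] K)

/-- The canonical isometric embedding of the algebraic tensor product. -/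
def toH (H K : Type*) [NormedAddCommGroup H] [InnerProductSpace ℂ H]
    [NormedAddCommGroup K] [InnerProductSpace ℂ K] : H ⊗[ℂ] K →ₗᵢ[ℂ] HTensor H K :=
  UniformSpace.Completion.toComplₗᵢ

/-- The elementary tensor `x ⊗ y` in the Hilbertian tensor product. -/
def htmul (x : H) (y : K) : HTensor H K := toH H K (x ⊗ₜ[ℂ] y)

theorem denseRange_toH : DenseRange (toH H K) := UniformSpace.Completion.denseRange_coe

theorem inner_htmul (x x' : H) (y y' : K) :
    inner ℂ (htmul x y) (htmul x' y') = inner ℂ x x' * inner ℂ y y' := by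
  simp [htmul]

/-- Two bounded linear maps that agree on elementary tensors are equal. -/
theorem ext_htmul {f g : HTensor H K →L[ℂ] M} (h : ∀ x y, f (htmul x y) = g (htmul x y)) :
    f = g := by
  refine ContinuousLinearMap.coeFn_injective (denseRange_toH.equalizer f.cont g.cont ?_)
  have : f.toLinearMap ∘ₗ (toH H K).toLinearMap = g.toLinearMap ∘ₗ (toH H K).toLinearMap :=
    TensorProduct.ext' h
  funext t
  exact LinearMap.congr_fun this t

/-- The tensor product `f ⊗ g` of two bounded linear maps. -/
def hmap (f : H →L[ℂ] L) (g : K →L[ℂ] M) : HTensor H K →L[ℂ] HTensor L M :=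
  ContinuousLinearMap.extend
    ((toH L M).toContinuousLinearMap ∘L TensorProduct.mapL f g) (toH H K).toContinuousLinearMap

@[simp] theorem hmap_htmul (f : H →L[ℂ] L) (g : K →L[ℂ] M) (x : H) (y : K) :
    hmap f g (htmul x y) = htmul (f x) (g y) :=
  ContinuousLinearMap.extend_eq (e := (toH H K).toContinuousLinearMap) _ denseRange_toH
    (toH H K).isometry.isUniformInducing (x ⊗ₜ[ℂ] y)

/-- The symmetry `H ⊗ K ≃ K ⊗ H`, a unitary map. -/
def hcomm (H K : Type*) [NormedAddCommGroup H] [InnerProductSpace ℂ H]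
    [NormedAddCommGroup K] [InnerProductSpace ℂ K] : HTensor H K ≃ₗᵢ[ℂ] HTensor K H :=
  (TensorProduct.comm ℂ H K).extendOfIsometry (toH H K).toLinearMap (toH K H).toLinearMap
    denseRange_toH denseRange_toH (fun t => by
      simp only [LinearIsometry.coe_toLinearMap, LinearIsometry.norm_map]
      exact TensorProduct.norm_comm t)

@[simp] theorem hcomm_htmul (x : H) (y : K) : hcomm H K (htmul x y) = htmul y x :=
  LinearEquiv.extendOfIsometry_eq (f := TensorProduct.comm ℂ H K) (e₁ := (toH H K).toLinearMap)
    (e₂ := (toH K H).toLinearMap) _ _ _ (x ⊗ₜ[ℂ] y)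

/-- The isometric embedding of `(H ⊗ K) ⊗ L` (algebraic) into its Hilbertian version. -/
def toHL (H K L : Type*) [NormedAddCommGroup H] [InnerProductSpace ℂ H]
    [NormedAddCommGroup K] [InnerProductSpace ℂ K] [NormedAddCommGroup L] [InnerProductSpace ℂ L] :
    (H ⊗[ℂ] K) ⊗[ℂ] L →ₗᵢ[ℂ] HTensor (HTensor H K) L :=
  (toH (HTensor H K) L).comp (TensorProduct.mapIsometry (toH H K) LinearIsometry.id)

/-- The isometric embedding of `H ⊗ (K ⊗ L)` (algebraic) into its Hilbertian version. -/
def toHR (H K L : Type*) [NormedAddCommGroup H] [InnerProductSpace ℂ H]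
    [NormedAddCommGroup K] [InnerProductSpace ℂ K] [NormedAddCommGroup L] [InnerProductSpace ℂ L] :
    H ⊗[ℂ] (K ⊗[ℂ] L) →ₗᵢ[ℂ] HTensor H (HTensor K L) :=
  (toH H (HTensor K L)).comp (TensorProduct.mapIsometry LinearIsometry.id (toH K L))

theorem continuous_htmul : Continuous fun p : H × K => htmul p.1 p.2 :=
  (toH H K).continuous.comp TensorProduct.continuous_tmul

/-- A submodule-closure criterion for density: the closure of the range contains all elementary
tensors. -/
theorem denseRange_of_htmul {V : Type*} [AddCommGroup V] [Module ℂ V] (e : V →ₗ[ℂ] HTensor H K)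
    (h : ∀ x y, htmul x y ∈ closure (Set.range e)) : DenseRange e := by
  have h2 : ∀ t : H ⊗[ℂ] K, toH H K t ∈ (LinearMap.range e).topologicalClosure := by
    intro t
    induction t with
    | zero => simp
    | tmul x y => simpa [← SetLike.mem_coe, Submodule.topologicalClosure_coe] using! h x y
    | add a b ha hb => rw [map_add]; exact add_mem ha hb
  intro z
  refine denseRange_toH.induction_on (p := fun z => z ∈ closure (Set.range e)) z
    isClosed_closure (fun t => ?_)
  simpa [← SetLike.mem_coe, Submodule.topologicalClosure_coe] using! h2 t

theorem denseRange_toHL : DenseRange (toHL H K L) := by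
  refine denseRange_of_htmul (toHL H K L).toLinearMap (fun s z => ?_)
  refine denseRange_toH.induction_on
    (p := fun s => htmul s z ∈ closure (Set.range (toHL H K L).toLinearMap)) s ?_ (fun t => ?_)
  · exact isClosed_closure.preimage (continuous_htmul.comp (by fun_prop : Continuous fun s => (s, z)))
  · exact subset_closure ⟨t ⊗ₜ[ℂ] z, rfl⟩

theorem denseRange_toHR : DenseRange (toHR H K L) := by
  refine denseRange_of_htmul (toHR H K L).toLinearMap (fun x s => ?_)
  refine denseRange_toH.induction_on
    (p := fun s => htmul x s ∈ closure (Set.range (toHR H K L).toLinearMap)) s ?_ (fun t => ?_)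
  · exact isClosed_closure.preimage (continuous_htmul.comp (by fun_prop : Continuous fun s => (x, s)))
  · exact subset_closure ⟨x ⊗ₜ[ℂ] t, rfl⟩

/-- The associativity constraint `(H ⊗ K) ⊗ L ≃ H ⊗ (K ⊗ L)`, a unitary map. -/
def hassoc (H K L : Type*) [NormedAddCommGroup H] [InnerProductSpace ℂ H]
    [NormedAddCommGroup K] [InnerProductSpace ℂ K] [NormedAddCommGroup L] [InnerProductSpace ℂ L] :
    HTensor (HTensor H K) L ≃ₗᵢ[ℂ] HTensor H (HTensor K L) :=
  (TensorProduct.assoc ℂ H K L).extendOfIsometry (toHL H K L).toLinearMap (toHR H K L).toLinearMap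
    denseRange_toHL denseRange_toHR (fun t => by
      simp only [LinearIsometry.coe_toLinearMap, LinearIsometry.norm_map]
      exact TensorProduct.norm_assoc t)

@[simp] theorem hassoc_htmul (x : H) (y : K) (z : L) :
    hassoc H K L (htmul (htmul x y) z) = htmul x (htmul y z) :=
  LinearEquiv.extendOfIsometry_eq (f := TensorProduct.assoc ℂ H K L)
    (e₁ := (toHL H K L).toLinearMap) (e₂ := (toHR H K L).toLinearMap) _ _ _ ((x ⊗ₜ[ℂ] y) ⊗ₜ[ℂ] z)

/-! ### Hilbertian Frobenius semigroups -/

/-- The comultiplication of a bounded multiplication: its Hilbert space adjoint. -/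
abbrev comul [CompleteSpace H] (μ : HTensor H H →L[ℂ] H) : H →L[ℂ] HTensor H H :=
  ContinuousLinearMap.adjoint μ

/-- `μ` is the multiplication of a commutative Hilbertian Frobenius semigroup on `H`. -/
structure IsFrobenius [CompleteSpace H] (μ : HTensor H H →L[ℂ] H) : Prop where
  comm : μ ∘L (hcomm H H : HTensor H H →L[ℂ] HTensor H H) = μ
  assoc : μ ∘L hmap μ (.id ℂ H) =
    μ ∘L hmap (.id ℂ H) μ ∘L
      (hassoc H H H : HTensor (HTensor H H) H →L[ℂ] HTensor H (HTensor H H))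
  frobenius_left : comul μ ∘L μ =
    hmap (.id ℂ H) μ ∘L
      (hassoc H H H : HTensor (HTensor H H) H →L[ℂ] HTensor H (HTensor H H)) ∘L
      hmap (comul μ) (.id ℂ H)
  frobenius_right : comul μ ∘L μ =
    hmap μ (.id ℂ H) ∘L
      ((hassoc H H H).symm : HTensor H (HTensor H H) →L[ℂ] HTensor (HTensor H H) H) ∘L
      hmap (.id ℂ H) (comul μ)

/-- Special: the multiplication is coisometric, i.e. the comultiplication is an isometry. -/
def IsSpecial [CompleteSpace H] (μ : HTensor H H →L[ℂ] H) : Prop :=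
  μ ∘L comul μ = .id ℂ H

/-- A partial isometry: `f f† f = f`. -/
def IsPartialIsometry [CompleteSpace H] [CompleteSpace K] (f : H →L[ℂ] K) : Prop :=
  f ∘L ContinuousLinearMap.adjoint f ∘L f = f

/-- The group-like elements: `x ≠ 0` with `μ†(x) = x ⊗ x`. -/
def groupLike [CompleteSpace H] (μ : HTensor H H →L[ℂ] H) : Set H :=
  {x | x ≠ 0 ∧ comul μ x = htmul x x}

/-! ### The Jacobson radical of the underlying (not necessarily unital) algebra -/

/-- A left ideal of the algebra `H` with product `x y = μ (x ⊗ y)`. -/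
def IsLeftIdeal (μ : HTensor H H →L[ℂ] H) (I : Submodule ℂ H) : Prop :=
  ∀ a : H, ∀ x ∈ I, μ (htmul a x) ∈ I

/-- A left ideal is modular if the algebra has a right identity modulo it. -/
def IsModular (μ : HTensor H H →L[ℂ] H) (I : Submodule ℂ H) : Prop :=
  ∃ e : H, ∀ x : H, x - μ (htmul x e) ∈ I

/-- Maximal modular left ideals: modular, and maximal among the proper left ideals. -/
structure IsMaximalModular (μ : HTensor H H →L[ℂ] H) (I : Submodule ℂ H) : Prop where
  isLeftIdeal : IsLeftIdeal μ I
  isModular : IsModular μ I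
  ne_top : I ≠ ⊤
  maximal : ∀ I' : Submodule ℂ H, IsLeftIdeal μ I' → I ≤ I' → I' ≠ ⊤ → I' = I

/-- The Jacobson radical: the intersection of all maximal modular left ideals (all of `H` if there
are none). -/
def jacobson (μ : HTensor H H →L[ℂ] H) : Submodule ℂ H :=
  sInf {I | IsMaximalModular μ I}

def IsSemisimple (μ : HTensor H H →L[ℂ] H) : Prop := jacobson μ = ⊥

def IsRadical (μ : HTensor H H →L[ℂ] H) : Prop := jacobson μ = ⊤

/-- `U` is a unitary isomorphism of semigroups `(H, μ) → (K, ν)`. -/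
def IsUnitaryIso (μ : HTensor H H →L[ℂ] H) (ν : HTensor K K →L[ℂ] K) (U : H ≃ₗᵢ[ℂ] K) : Prop :=
  (U : H →L[ℂ] K) ∘L μ = ν ∘L hmap (U : H →L[ℂ] K) (U : H →L[ℂ] K)

/-! ### Orthogonal sets -/

/-- A set of pairwise orthogonal non-zero vectors. -/
def IsOrthogonalSet (X : Set H) : Prop :=
  (0 : H) ∉ X ∧ X.Pairwise fun x y => inner ℂ x y = 0

/-- An orthogonal set in which every vector has norm one. -/
def IsOrthonormalSet (X : Set H) : Prop :=
  IsOrthogonalSet X ∧ ∀ x ∈ X, ‖x‖ = 1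

/-- The orthogonal complement of `X` is zero. -/
def IsTotal (X : Set H) : Prop := ∀ u : H, (∀ x ∈ X, inner ℂ x u = 0) → u = 0

def IsBddAbove (X : Set H) : Prop := ∃ C : ℝ, 0 < C ∧ ∀ x ∈ X, ‖x‖ ≤ C

end

end HilbFrob

/-! Write `L_a` for multiplication by `a`. Tested against elementary tensors, the Frobenius law says
that each adjoint `L_b†` commutes with every `L_c`. So the `L_a` are commuting normal operators and
generate a commutative C*-algebra, whose characters separate its elements by Gelfand's theorem.
Composed with `a ↦ L_a`, a character is zero or, by Riesz, is represented by a group-like element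
(`exists_groupLike_inner_ne_zero`). Hence a vector orthogonal to all group-like elements annihilates
the algebra, and the Frobenius law makes it orthogonal to all products. Two group-like elements have
a product that is a multiple of each, so distinct ones are orthogonal. Thus `μ` is diagonal with
respect to `groupLike μ` (`IsFrobenius.isDiagonal`) and determined by it. Conversely, a bounded
orthogonal set `X` yields the operator `e_x ⊗ e_x ↦ ‖x‖ e_x`, where `e_x = x / ‖x‖`, and its
group-like elements are exactly `X`. The special cases follow because the Jacobson radical is the
orthogonal complement of the group-like elements and `μ μ†` scales each such `g` by `‖g‖²`. -/

namespace HilbFrob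

open ContinuousLinearMap (adjoint)

/-! ### Characters of commuting normal operators -/

/-- A set of commuting operators, each commuting with the adjoints of all, is separated from zero
by the characters of the C*-algebra it generates. -/
theorem exists_continuousLinearMap_mul_of_commute {A : Type*} [CStarAlgebra A] {s : Set A}
    (hcomm : ∀ x ∈ s, ∀ y ∈ s, x * y = y * x)
    (hstar : ∀ x ∈ s, ∀ y ∈ s, x * star y = star y * x) {a : A} (ha : a ∈ s) (ha0 : a ≠ 0) :
    ∃ (S : StarSubalgebra ℂ A) (hS : s ⊆ S) (φ : S →L[ℂ] ℂ),
      φ ⟨a, hS ha⟩ ≠ 0 ∧ ∀ x y, φ (x * y) = φ x * φ y := by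
  have hC := StarAlgebra.isMulCommutative_adjoin ℂ hcomm hstar
  let S := (StarAlgebra.adjoin ℂ s).topologicalClosure
  have hsS : s ⊆ S := (StarAlgebra.subset_adjoin ℂ s).trans
    (StarAlgebra.adjoin ℂ s).le_topologicalClosure
  let : CStarAlgebra S :=
    StarSubalgebra.cstarAlgebra S (h_closed := StarSubalgebra.isClosed_topologicalClosure _)
  have hmul : ∀ x y : S, x * y = y * x :=
    ((StarAlgebra.adjoin ℂ s).commRingTopologicalClosure
      (fun x y => hC.is_comm.comm x y)).mul_comm
  let : CommCStarAlgebra S := { (inferInstance : CStarAlgebra S) with mul_comm := hmul }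
  -- The Gelfand transform is isometric, so some character does not vanish at `a`.
  have hne : WeakDual.gelfandTransform ℂ S ⟨a, hsS ha⟩ ≠ 0 := by
    intro h
    have := (gelfandTransform_isometry S).injective (h.trans (map_zero _).symm)
    exact ha0 (congrArg Subtype.val this)
  obtain ⟨φ, hφ⟩ := DFunLike.ne_iff.mp hne
  exact ⟨S, hsS, WeakDual.CharacterSpace.toCLM φ, hφ, fun x y => map_mul φ x y⟩

noncomputable section

variable {H K L M : Type*}
  [NormedAddCommGroup H] [InnerProductSpace ℂ H]
  [NormedAddCommGroup K] [InnerProductSpace ℂ K]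
  [NormedAddCommGroup L] [InnerProductSpace ℂ L]
  [NormedAddCommGroup M] [InnerProductSpace ℂ M]

/-! ### Calculus of elementary tensors -/

theorem htmul_add_right (x : H) (y y' : K) : htmul x (y + y') = htmul x y + htmul x y' := by
  simp [htmul, TensorProduct.tmul_add]

theorem htmul_smul_right (c : ℂ) (x : H) (y : K) : htmul x (c • y) = c • htmul x y := by
  simp [htmul]

theorem htmul_smul_left (c : ℂ) (x : H) (y : K) : htmul (c • x) y = c • htmul x y := by
  rw [htmul, ← TensorProduct.smul_tmul', map_smul, htmul]

theorem htmul_zero_left (y : K) : htmul (0 : H) y = 0 := by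
  simp [htmul]

theorem htmul_zero_right (x : H) : htmul x (0 : K) = 0 := by
  simp [htmul]

theorem norm_htmul (x : H) (y : K) : ‖htmul x y‖ = ‖x‖ * ‖y‖ := by
  simp [htmul]

/-- Tensoring with a fixed vector on the left, as a bounded linear map. -/
def htmulLeft (K : Type*) [NormedAddCommGroup K] [InnerProductSpace ℂ K] (x : H) :
    K →L[ℂ] HTensor H K :=
  LinearMap.mkContinuous
    { toFun := htmul x
      map_add' := htmul_add_right x
      map_smul' := fun c => htmul_smul_right c x } ‖x‖ (fun y => (norm_htmul x y).le)

@[simp] theorem htmulLeft_apply (x : H) (y : K) : htmulLeft K x y = htmul x y := rfl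

theorem continuous_htmul_left (y : K) : Continuous fun x : H => htmul x y :=
  continuous_htmul.comp (by fun_prop : Continuous fun x : H => (x, y))

theorem continuous_htmul_right (x : H) : Continuous fun y : K => htmul x y :=
  continuous_htmul.comp (by fun_prop : Continuous fun y : K => (x, y))

/-- A closed additive property holds on the Hilbertian tensor product as soon as it holds at zero
and on elementary tensors. -/
theorem htensor_induction {p : HTensor H K → Prop} (hp : IsClosed {s | p s})
    (zero : p 0) (add : ∀ s t, p s → p t → p (s + t)) (htm : ∀ x y, p (htmul x y))
    (s : HTensor H K) : p s := by
  refine denseRange_toH.induction_on s hp fun t => ?_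
  induction t with
  | zero => simpa using zero
  | tmul x y => exact htm x y
  | add a b ha hb => rw [map_add]; exact add _ _ ha hb

theorem htmul_add_left (x x' : H) (y : K) : htmul (x + x') y = htmul x y + htmul x' y := by
  simp [htmul, TensorProduct.add_tmul]

/-- A vector of the Hilbertian tensor product is determined by its inner products with elementary
tensors. -/
theorem htensor_ext {s t : HTensor H K}
    (h : ∀ x y, inner ℂ (htmul x y) s = inner ℂ (htmul x y) t) : s = t := by
  refine ext_inner_left ℂ fun v => ?_
  induction v using htensor_induction with
  | hp => exact isClosed_eq (by fun_prop) (by fun_prop)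
  | zero => simp
  | add a b ha hb => rw [inner_add_left, inner_add_left, ha, hb]
  | htm x y => exact h x y

/-! ### The Frobenius law in terms of multiplication operators -/

/-- Left multiplication by `a` in the algebra with product `μ (x ⊗ y)`. -/
def mulLeft (μ : HTensor H H →L[ℂ] H) (a : H) : H →L[ℂ] H := μ ∘L htmulLeft H a

@[simp] theorem mulLeft_apply (μ : HTensor H H →L[ℂ] H) (a b : H) :
    mulLeft μ a b = μ (htmul a b) := rfl

variable [CompleteSpace H]

theorem inner_htmul_comul (μ : HTensor H H →L[ℂ] H) (c d a : H) :
    inner ℂ (htmul c d) (comul μ a) = inner ℂ (μ (htmul c d)) a :=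
  ContinuousLinearMap.adjoint_inner_right _ _ _

/-- Evaluates the right side of the Frobenius law weakly, with any `s` in place of `μ†(a)`, which
need not be an elementary tensor. The symmetry appears because `b` multiplies from the right. -/
theorem inner_hmap_id_hassoc (μ : HTensor H H →L[ℂ] H) (c d b : H) (s : HTensor H H) :
    inner ℂ (htmul c d) (hmap (.id ℂ H) μ (hassoc H H H (htmul s b))) =
      inner ℂ (htmul c (adjoint (mulLeft (μ ∘L (hcomm H H : HTensor H H →L[ℂ] HTensor H H)) b) d))
        s := by
  induction s using htensor_induction with
  | hp =>
    have := continuous_htmul_left (H := HTensor H H) b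
    exact isClosed_eq (by fun_prop) (by fun_prop)
  | zero => simp [htmul_zero_left]
  | add x y hx hy =>
    rw [htmul_add_left, map_add, map_add, inner_add_right, inner_add_right, hx, hy]
  | htm x y =>
    simp [inner_htmul, ContinuousLinearMap.adjoint_inner_left]

theorem inner_hmap_id_hassoc_symm (μ : HTensor H H →L[ℂ] H) (c d a : H) (s : HTensor H H) :
    inner ℂ (htmul c d) (hmap μ (.id ℂ H) ((hassoc H H H).symm (htmul a s))) =
      inner ℂ (htmul (adjoint (mulLeft μ a) c) d) s := by
  induction s using htensor_induction with
  | hp =>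
    have := continuous_htmul_right (K := HTensor H H) a
    exact isClosed_eq (by fun_prop) (by fun_prop)
  | zero => simp [htmul_zero_right]
  | add x y hx hy =>
    rw [htmul_add_right, map_add, map_add, inner_add_right, inner_add_right, hx, hy]
  | htm x y =>
    rw [← hassoc_htmul, LinearIsometryEquiv.symm_apply_apply]
    simp [inner_htmul, ContinuousLinearMap.adjoint_inner_left]

/-- A multiplication is Frobenius exactly if it is commutative and associative and the adjoints of
the multiplication operators are module maps. -/
theorem isFrobenius_iff (μ : HTensor H H →L[ℂ] H) :
    IsFrobenius μ ↔ (∀ a b, μ (htmul a b) = μ (htmul b a)) ∧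
      (∀ a b c, μ (htmul (μ (htmul a b)) c) = μ (htmul a (μ (htmul b c)))) ∧
      ∀ b c d, adjoint (mulLeft μ b) (μ (htmul c d)) = μ (htmul c (adjoint (mulLeft μ b) d)) := by
  have hcm : (∀ a b, μ (htmul a b) = μ (htmul b a)) →
      μ ∘L (hcomm H H : HTensor H H →L[ℂ] HTensor H H) = μ := fun h =>
    ext_htmul fun x y => by simp [h x y]
  constructor
  · intro h
    refine ⟨fun a b => ?_, fun a b c => ?_, fun b c d => ?_⟩
    · simpa using (DFunLike.congr_fun h.comm (htmul b a))
    · simpa using DFunLike.congr_fun h.assoc (htmul (htmul a b) c)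
    -- Pairing the law at `a ⊗ b` with `c ⊗ d` gives `⟪cd, ab⟫ = ⟪c (L_b† d), a⟫`.
    · refine ext_inner_right ℂ fun a => ?_
      have h1 := congrArg (inner ℂ (htmul c d)) (DFunLike.congr_fun h.frobenius_left (htmul a b))
      have h2 := inner_hmap_id_hassoc μ c d b (comul μ a)
      rw [h.comm] at h2
      simp only [ContinuousLinearMap.comp_apply, hmap_htmul, ContinuousLinearMap.id_apply,
        inner_htmul_comul] at h1 h2
      erw [h2] at h1
      rw [ContinuousLinearMap.adjoint_inner_left, ← h1, mulLeft_apply]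
      congr 1
      simpa using (DFunLike.congr_fun h.comm (htmul a b))
  · rintro ⟨h1, h2, h3⟩
    -- The first factor of `(H ⊗ H) ⊗ H` ranges over the completion, so associativity is first
    -- extended to it by density.
    have hassoc3 : ∀ (s : HTensor H H) (c : H), μ (htmul (μ s) c) =
        μ (hmap (.id ℂ H) μ (hassoc H H H (htmul s c))) := by
      intro s c
      induction s using htensor_induction with
      | hp =>
        have := continuous_htmul_left (H := HTensor H H) c
        have := continuous_htmul_left (H := H) c
        exact isClosed_eq (by fun_prop) (by fun_prop)
      | zero => simp [htmul_zero_left]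
      | add x y hx hy => simp only [htmul_add_left, map_add, hx, hy]
      | htm x y => simp [h2]
    refine ⟨hcm h1, ext_htmul fun s c => ?_, ext_htmul fun a b => htensor_ext fun c d => ?_,
      ext_htmul fun a b => htensor_ext fun c d => ?_⟩
    · simpa using hassoc3 s c
    · have h4 := inner_hmap_id_hassoc μ c d b (comul μ a)
      rw [hcm h1] at h4
      simp only [ContinuousLinearMap.comp_apply, hmap_htmul, ContinuousLinearMap.id_apply,
        inner_htmul_comul] at h4 ⊢
      erw [h4]
      rw [← h3, ContinuousLinearMap.adjoint_inner_left, mulLeft_apply, h1 a b]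
    · have h4 := inner_hmap_id_hassoc_symm μ c d a (comul μ b)
      simp only [ContinuousLinearMap.comp_apply, hmap_htmul, ContinuousLinearMap.id_apply,
        inner_htmul_comul] at h4 ⊢
      erw [h4]
      rw [h1 (adjoint (mulLeft μ a) c) d, ← h3, ContinuousLinearMap.adjoint_inner_left,
        mulLeft_apply, h1 c d]

end

end HilbFrob

namespace HilbFrob

open ContinuousLinearMap (adjoint)

noncomputable section

variable {H : Type*} [NormedAddCommGroup H] [InnerProductSpace ℂ H]

/-! ### Diagonal multiplications -/

/-- Two vectors of the closed span of `X` agree if they have the same inner products with all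
elements of `X`. -/
theorem eq_of_inner_eq {X : Set H} {w w' : H} (h : ∀ x ∈ X, inner ℂ x w = inner ℂ x w')
    (hw : ∀ n, (∀ x ∈ X, inner ℂ x n = 0) → inner ℂ n w = 0)
    (hw' : ∀ n, (∀ x ∈ X, inner ℂ x n = 0) → inner ℂ n w' = 0) : w = w' := by
  have h0 : ∀ x ∈ X, inner ℂ x (w - w') = 0 := fun x hx => by
    rw [inner_sub_right, h x hx, sub_self]
  rw [← sub_eq_zero, ← inner_self_eq_zero (𝕜 := ℂ), inner_sub_right, hw _ h0, hw' _ h0, sub_self]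

/-- `μ` is diagonal with respect to `X`: the elements of `X` give characters, and all products lie
in the closed span of `X`. -/
structure IsDiagonal (X : Set H) (μ : HTensor H H →L[ℂ] H) : Prop where
  inner_mul : ∀ x ∈ X, ∀ u v, inner ℂ x (μ (htmul u v)) = inner ℂ x u * inner ℂ x v
  inner_mul_of_perp : ∀ n, (∀ x ∈ X, inner ℂ x n = 0) → ∀ u v, inner ℂ n (μ (htmul u v)) = 0

theorem IsDiagonal.unique {X : Set H} {μ ν : HTensor H H →L[ℂ] H} (hμ : IsDiagonal X μ)
    (hν : IsDiagonal X ν) : μ = ν :=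
  ext_htmul fun u v => eq_of_inner_eq (X := X)
    (fun x hx => (hμ.inner_mul x hx u v).trans (hν.inner_mul x hx u v).symm)
    (fun n hn => hμ.inner_mul_of_perp n hn u v) (fun n hn => hν.inner_mul_of_perp n hn u v)

theorem IsDiagonal.mul_of_perp {X : Set H} {μ : HTensor H H →L[ℂ] H} (hμ : IsDiagonal X μ)
    {n : H} (hn : ∀ x ∈ X, inner ℂ x n = 0) (v : H) : μ (htmul v n) = 0 :=
  eq_of_inner_eq (X := X) (fun x hx => by simp [hμ.inner_mul x hx, hn x hx])
    (fun m hm => hμ.inner_mul_of_perp m hm v n) (by simp)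

theorem IsDiagonal.mul_mem {X : Set H} (hX : IsOrthogonalSet X) {μ : HTensor H H →L[ℂ] H}
    (hμ : IsDiagonal X μ) {x : H} (hx : x ∈ X) (b : H) : μ (htmul b x) = inner ℂ x b • x := by
  refine eq_of_inner_eq (X := X) (fun y hy => ?_) (fun m hm => hμ.inner_mul_of_perp m hm b x) ?_
  · rw [hμ.inner_mul y hy, inner_smul_right]
    by_cases hxy : y = x
    · rw [hxy]
    · rw [hX.2 hy hx hxy, mul_zero, mul_zero]
  · intro n hn
    rw [inner_smul_right, inner_eq_zero_symm.1 (hn x hx), mul_zero]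

variable [CompleteSpace H]

/-- Moving `μ†` across the inner product turns group-like elements into Riesz representatives of the
non-zero bounded characters. -/
theorem mem_groupLike {μ : HTensor H H →L[ℂ] H} {g : H} :
    g ∈ groupLike μ ↔
      g ≠ 0 ∧ ∀ u v, inner ℂ g (μ (htmul u v)) = inner ℂ g u * inner ℂ g v := by
  refine and_congr_right fun _ => ⟨fun h u v => ?_, fun h => htensor_ext fun u v => ?_⟩
  · rw [← inner_conj_symm, ← inner_htmul_comul, h, inner_conj_symm, inner_htmul]
  · rw [inner_htmul_comul, inner_htmul, ← inner_conj_symm, h, map_mul, inner_conj_symm,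
      inner_conj_symm]

/-- All identities are checked on the coordinates `⟪x, ·⟫`, where the product is pointwise and
`L_b†` acts as the scalar `⟪b, x⟫`. -/
theorem IsDiagonal.isFrobenius {X : Set H} (hX : IsOrthogonalSet X) {μ : HTensor H H →L[ℂ] H}
    (hμ : IsDiagonal X μ) : IsFrobenius μ := by
  have hcomm : ∀ a b, μ (htmul a b) = μ (htmul b a) := fun a b =>
    eq_of_inner_eq (X := X) (fun x hx => by rw [hμ.inner_mul x hx, hμ.inner_mul x hx, mul_comm])
      (fun n hn => hμ.inner_mul_of_perp n hn a b) (fun n hn => hμ.inner_mul_of_perp n hn b a)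
  refine (isFrobenius_iff μ).2 ⟨hcomm, fun a b c => ?_, fun b c d => ?_⟩
  · refine eq_of_inner_eq (X := X) (fun x hx => ?_) (fun n hn => hμ.inner_mul_of_perp n hn _ _)
      (fun n hn => hμ.inner_mul_of_perp n hn _ _)
    simp only [hμ.inner_mul x hx, mul_assoc]
  · have hadj : ∀ x ∈ X, ∀ y, inner ℂ x (adjoint (mulLeft μ b) y) = inner ℂ b x * inner ℂ x y := by
      intro x hx y
      rw [ContinuousLinearMap.adjoint_inner_right, mulLeft_apply, hμ.mul_mem hX hx,
        inner_smul_left, inner_conj_symm]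
    refine eq_of_inner_eq (X := X) (fun x hx => ?_) (fun n hn => ?_)
      (fun n hn => hμ.inner_mul_of_perp n hn _ _)
    · rw [hadj x hx, hμ.inner_mul x hx, hμ.inner_mul x hx, hadj x hx]
      ring
    · rw [ContinuousLinearMap.adjoint_inner_right, mulLeft_apply, hμ.mul_of_perp hn, inner_zero_left]

/-! ### Group-like elements of a Frobenius semigroup -/

section Frobenius

variable {μ : HTensor H H →L[ℂ] H} (hμ : IsFrobenius μ)

include hμ

theorem IsFrobenius.mul_comm (a b : H) : μ (htmul a b) = μ (htmul b a) :=
  ((isFrobenius_iff μ).1 hμ).1 a b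

/-- Since `g` is an eigenvector of every `L_b†`, so is `w = cg` by the Frobenius law, which gives
`⟪w, bu⟫ = ⟪g, b⟫ ⟪w, u⟫`. The left side is symmetric in `b` and `u`; taking `b = g` forces `w` to
be a multiple of `g`. -/
theorem IsFrobenius.mul_groupLike {g : H} (hg : g ∈ groupLike μ) (c : H) :
    μ (htmul c g) = inner ℂ g c • g := by
  obtain ⟨hg0, hg⟩ := mem_groupLike.1 hg
  have hadj : ∀ b, adjoint (mulLeft μ b) g = inner ℂ b g • g := fun b =>
    ext_inner_right ℂ fun v => by
      rw [ContinuousLinearMap.adjoint_inner_left, mulLeft_apply, hg, inner_smul_left,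
        inner_conj_symm]
  have h1 : ∀ b u, inner ℂ (μ (htmul c g)) (μ (htmul b u)) =
      inner ℂ g b * inner ℂ (μ (htmul c g)) u := fun b u => by
    have := ((isFrobenius_iff μ).1 hμ).2.2 b c g
    rw [← mulLeft_apply μ b u, ← ContinuousLinearMap.adjoint_inner_left, this, hadj,
      htmul_smul_right, map_smul, inner_smul_left, inner_conj_symm]
  have hgg : inner ℂ g g ≠ 0 := inner_self_ne_zero.2 hg0
  refine ext_inner_right ℂ fun u => mul_left_cancel₀ hgg ?_
  rw [← h1, hμ.mul_comm g u, h1, inner_smul_left, inner_conj_symm,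
    ← inner_conj_symm (μ (htmul c g)) g, hg c g, map_mul, inner_conj_symm, inner_conj_symm]
  ring

theorem IsFrobenius.isOrthogonalSet : IsOrthogonalSet (groupLike μ) := by
  refine ⟨fun h => h.1 rfl, fun g hg k hk hne => ?_⟩
  by_contra h
  -- The product of `g` and `k` computed in two ways: if not orthogonal, they are parallel, and the
  -- quadratic character identity then forces the factor `t` to be `1`.
  have h1 : inner ℂ k g • k = inner ℂ g k • g := by
    rw [← hμ.mul_groupLike hk, hμ.mul_comm, hμ.mul_groupLike hg]
  obtain ⟨t, rfl⟩ : ∃ t : ℂ, g = t • k :=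
    ⟨(inner ℂ g k)⁻¹ * inner ℂ k g, by rw [mul_smul, h1, inv_smul_smul₀ h]⟩
  have h2 := (mem_groupLike.1 hg).2 k k
  have hkk : inner ℂ k k ≠ 0 := inner_self_ne_zero.2 hk.1
  have ht : t ≠ 0 := fun ht => hg.1 (by rw [ht, zero_smul])
  rw [inner_smul_left, inner_smul_left, (mem_groupLike.1 hk).2] at h2
  have ht' : (starRingEnd ℂ) t ≠ 0 := by simpa using ht
  have h3 : (starRingEnd ℂ) t = 1 := by
    have h4 : (starRingEnd ℂ) t * (inner ℂ k k * inner ℂ k k) * ((starRingEnd ℂ) t - 1) = 0 := by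
      linear_combination -h2
    have := (mul_eq_zero.1 h4).resolve_left (mul_ne_zero ht' (mul_ne_zero hkk hkk))
    exact sub_eq_zero.1 this
  have h5 : t = 1 := by simpa using congrArg (starRingEnd ℂ) h3
  exact hne (by rw [h5, one_smul])

/-- The product `g g = ‖g‖² g` has norm `‖g‖³`, while `g ⊗ g` has norm `‖g‖²`. -/
theorem IsFrobenius.norm_le_of_mem_groupLike {g : H} (hg : g ∈ groupLike μ) : ‖g‖ ≤ ‖μ‖ := by
  have h := μ.le_opNorm (htmul g g)
  rw [hμ.mul_groupLike hg, norm_smul, norm_htmul, inner_self_eq_norm_sq_to_K] at h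
  have hpos : 0 < ‖g‖ := norm_pos_iff.2 hg.1
  simp only [norm_pow, RCLike.norm_ofReal, abs_norm] at h
  refine le_of_mul_le_mul_left ?_ (mul_pos hpos hpos)
  linarith

theorem IsFrobenius.isBddAbove : IsBddAbove (groupLike μ) :=
  ⟨‖μ‖ + 1, by positivity, fun _ hg => (hμ.norm_le_of_mem_groupLike hg).trans (by linarith)⟩

/-- The group-like elements separate the points of the algebra modulo its annihilator. -/
theorem IsFrobenius.exists_groupLike_inner_ne_zero {c : H} (hc : mulLeft μ c ≠ 0) :
    ∃ g ∈ groupLike μ, inner ℂ g c ≠ 0 := by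
  obtain ⟨hcomm, hassoc, hfrob⟩ := (isFrobenius_iff μ).1 hμ
  have hmulL : ∀ a b, mulLeft μ (μ (htmul a b)) = mulLeft μ a * mulLeft μ b := fun a b => by
    ext v
    simp [hassoc]
  obtain ⟨S, hS, φ, hφc, hφ⟩ := exists_continuousLinearMap_mul_of_commute
    (s := Set.range (mulLeft μ))
    (by
      rintro _ ⟨a, rfl⟩ _ ⟨b, rfl⟩
      rw [← hmulL, ← hmulL, hcomm])
    (by
      rintro _ ⟨a, rfl⟩ _ ⟨b, rfl⟩
      ext v
      exact (hfrob b a v).symm)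
    ⟨c, rfl⟩ hc
  -- The character pulled back along `a ↦ L_a` is a bounded functional on `H`; Riesz turns it into
  -- the group-like element.
  let Λ : H →L[ℂ] S := LinearMap.mkContinuous
    { toFun := fun a => ⟨mulLeft μ a, hS ⟨a, rfl⟩⟩
      map_add' := fun a b => Subtype.ext (by ext v; simp [htmul_add_left])
      map_smul' := fun t a => Subtype.ext (by ext v; simp [htmul_smul_left]) } ‖μ‖
    (fun a => ContinuousLinearMap.opNorm_le_bound _ (by positivity) fun v => by
      rw [mul_assoc, ← norm_htmul]
      exact μ.le_opNorm _)
  obtain ⟨g, hg⟩ := (InnerProductSpace.toDual ℂ H).surjective (φ ∘L Λ)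
  have hg' : ∀ a, inner ℂ g a = φ (Λ a) := fun a => by
    rw [← InnerProductSpace.toDual_apply_apply, hg]; rfl
  have hgc : inner ℂ g c ≠ 0 := by rw [hg']; exact hφc
  refine ⟨g, mem_groupLike.2 ⟨fun h => hgc (by rw [h, inner_zero_left]), fun u v => ?_⟩, hgc⟩
  rw [hg', hg', hg', ← hφ]
  congr 1
  exact Subtype.ext (hmulL u v)

/-- If `n` is orthogonal to all group-like elements then `L_n = 0`. For `w = L_u† n` the Frobenius
law gives `c w = L_u†(c n) = 0` for all `c`, so `⟪w, w⟫ = ⟪n, u w⟫ = 0` and `⟪n, u v⟫ = ⟪w, v⟫ = 0`.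
-/
theorem IsFrobenius.isDiagonal : IsDiagonal (groupLike μ) μ := by
  refine ⟨fun x hx => (mem_groupLike.1 hx).2, fun n hn u v => ?_⟩
  have hann : ∀ w, (∀ g ∈ groupLike μ, inner ℂ g w = 0) → mulLeft μ w = 0 := by
    intro w hw
    by_contra h
    obtain ⟨g, hg, hgw⟩ := hμ.exists_groupLike_inner_ne_zero h
    exact hgw (hw g hg)
  have h1 : ∀ c, μ (htmul c (adjoint (mulLeft μ u) n)) = 0 := fun c => by
    rw [← ((isFrobenius_iff μ).1 hμ).2.2, hμ.mul_comm, ← mulLeft_apply, hann n hn]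
    simp
  have h2 : adjoint (mulLeft μ u) n = 0 := by
    rw [← inner_self_eq_zero (𝕜 := ℂ), ContinuousLinearMap.adjoint_inner_left, mulLeft_apply, h1,
      inner_zero_right]
  rw [← mulLeft_apply, ← ContinuousLinearMap.adjoint_inner_left, h2, inner_zero_left]

end Frobenius

/-- A further group-like `g` would be orthogonal to `X`, hence to all products, contradicting `⟪g, g
g⟫ = ⟪g, g⟫² ≠ 0`. -/
theorem IsDiagonal.groupLike_eq {X : Set H} (hX : IsOrthogonalSet X) {μ : HTensor H H →L[ℂ] H}
    (hμ : IsDiagonal X μ) : groupLike μ = X := by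
  have hXG : X ⊆ groupLike μ := fun x hx =>
    mem_groupLike.2 ⟨fun h => hX.1 (h ▸ hx), hμ.inner_mul x hx⟩
  refine Set.Subset.antisymm (fun g hg => by_contra fun hgX => ?_) hXG
  have h1 : ∀ x ∈ X, inner ℂ x g = 0 := fun x hx =>
    (hμ.isFrobenius hX).isOrthogonalSet.2 (hXG hx) hg fun h => hgX (h ▸ hx)
  have h2 := hμ.inner_mul_of_perp g h1 g g
  rw [(mem_groupLike.1 hg).2] at h2
  exact hg.1 (inner_self_eq_zero.1 (mul_self_eq_zero.1 h2))

end

end HilbFrob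

namespace HilbFrob

open ContinuousLinearMap (adjoint)

noncomputable section

variable {H : Type*} [NormedAddCommGroup H] [InnerProductSpace ℂ H]

/-! ### Orthogonal sets and their cardinality -/

/-- The orthonormal family obtained by normalizing an orthogonal set. -/
theorem IsOrthogonalSet.orthonormal_normalize {X : Set H} (hX : IsOrthogonalSet X) :
    Orthonormal ℂ fun x : X => ((‖(x : H)‖ : ℂ)⁻¹) • (x : H) := by
  refine ⟨fun x => ?_, fun x y hxy => ?_⟩
  · have : ‖(x : H)‖ ≠ 0 := norm_ne_zero_iff.2 fun h => hX.1 (h ▸ x.2)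
    rw [norm_smul, norm_inv, Complex.norm_real, norm_norm, inv_mul_cancel₀ this]
  · simp only [inner_smul_left, inner_smul_right]
    rw [hX.2 x.2 y.2 (fun h => hxy (Subtype.ext h)), mul_zero, mul_zero]

theorem _root_.Orthonormal.htmul {ι K : Type*} [NormedAddCommGroup K] [InnerProductSpace ℂ K]
    {v : ι → H} {w : ι → K} (hv : Orthonormal ℂ v) (hw : Orthonormal ℂ w) :
    Orthonormal ℂ fun i => htmul (v i) (w i) :=
  ⟨fun i => by rw [norm_htmul, hv.1, hw.1, one_mul],
    fun i j hij => by
      change inner ℂ (HilbFrob.htmul (v i) (w i)) (HilbFrob.htmul (v j) (w j)) = 0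
      rw [inner_htmul, hv.2 hij, zero_mul]⟩

theorem norm_eq_one_of_sq_smul_eq {g : H} (hg : g ≠ 0) (h : ((‖g‖ : ℂ) ^ 2) • g = g) :
    ‖g‖ = 1 := by
  have h1 : ((‖g‖ : ℂ) ^ 2) = 1 := smul_left_injective ℂ hg (by simpa using h)
  have h2 : ‖g‖ ^ 2 = 1 := by exact_mod_cast h1
  exact (pow_eq_one_iff_of_nonneg (norm_nonneg _) two_ne_zero).1 h2

theorem IsOrthonormalSet.isBddAbove {X : Set H} (hX : IsOrthonormalSet X) : IsBddAbove X :=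
  ⟨1, one_pos, fun x hx => (hX.2 x hx).le⟩

theorem IsOrthonormalSet.orthonormal {X : Set H} (hX : IsOrthonormalSet X) :
    Orthonormal ℂ ((↑) : X → H) :=
  ⟨fun x => hX.2 x x.2, fun x y hxy => hX.1.2 x.2 y.2 fun h => hxy (Subtype.ext h)⟩

theorem IsTotal.span_orthogonal {X : Set H} (hX : IsTotal X) :
    (Submodule.span ℂ (Set.range ((↑) : X → H)))ᗮ = ⊥ := by
  rw [Subtype.range_coe, Submodule.eq_bot_iff]
  exact fun u hu => hX u fun x hx => Submodule.inner_right_of_mem_orthogonal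
    (Submodule.subset_span hx) hu

/-- The cardinality of an infinite total set bounds that of any orthonormal set. -/
theorem IsOrthonormalSet.mk_le_of_infinite {X Y : Set H} (hX : IsOrthonormalSet X)
    (hY : IsTotal Y) (hinf : Y.Infinite) : Cardinal.mk X ≤ Cardinal.mk Y := by
  -- By Bessel's inequality each `y` meets only countably many elements of `X`; by totality of `Y`
  -- every element of `X` is met.
  have hcount : ∀ y : Y, ({x : X | inner ℂ (x : H) (y : H) ≠ 0}).Countable := fun y => by
    have h := (hX.orthonormal.inner_products_summable (y : H)).countable_support
    refine h.mono fun x hx => ?_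
    simpa [Function.mem_support] using hx
  have hcover : (⋃ y : Y, {x : X | inner ℂ (x : H) (y : H) ≠ 0}) = Set.univ := by
    refine Set.eq_univ_of_forall fun x => ?_
    by_contra hx
    simp only [Set.mem_iUnion, Set.mem_ofPred_eq, not_exists, not_not] at hx
    have h0 := hY x fun y hy => inner_eq_zero_symm.1 (hx ⟨y, hy⟩)
    exact hX.1.1 (h0 ▸ x.2)
  have : Infinite Y := hinf.to_subtype
  calc Cardinal.mk X = Cardinal.mk (Set.univ : Set X) := Cardinal.mk_univ.symm
    _ ≤ Cardinal.mk Y * ⨆ y : Y, Cardinal.mk {x : X | inner ℂ (x : H) (y : H) ≠ 0} := by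
      rw [← hcover]; exact Cardinal.mk_iUnion_le _
    _ ≤ Cardinal.mk Y * Cardinal.aleph0 := by
      gcongr
      exact ciSup_le' fun y => Cardinal.le_aleph0_iff_set_countable.2 (hcount y)
    _ = Cardinal.mk Y := Cardinal.mul_aleph0_eq (Cardinal.aleph0_le_mk Y)

theorem isDiagonal_of_hasSum {X : Set H} (hX : IsOrthogonalSet X) {μ : HTensor H H →L[ℂ] H}
    (hμ : ∀ u v, HasSum (fun x : X =>
        ((inner ℂ (x : H) u * inner ℂ (x : H) v) / ((‖(x : H)‖ : ℂ) ^ 2)) • (x : H))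
        (μ (htmul u v))) : IsDiagonal X μ := by
  refine ⟨fun x hx u v => ?_, fun n hn u v => ?_⟩
  · have h := (hμ u v).mapL (innerSL ℂ x)
    refine h.unique ?_
    convert hasSum_single (⟨x, hx⟩ : X) (fun y hy => ?_) using 1
    · have hx0 : (‖x‖ : ℂ) ≠ 0 := by simpa using fun h : x = 0 => hX.1 (h ▸ hx)
      rw [innerSL_apply_apply, inner_smul_right, inner_self_eq_norm_sq_to_K]
      simp only [Complex.coe_algebraMap]
      field_simp
    · rw [innerSL_apply_apply, inner_smul_right,
        hX.2 hx y.2 (fun h => hy (Subtype.ext h.symm)), mul_zero]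
  · have hn' : ∀ y : X, inner ℂ n (y : H) = 0 := fun y => inner_eq_zero_symm.1 (hn y y.2)
    have h := (hμ u v).mapL (innerSL ℂ n)
    simp only [innerSL_apply_apply, inner_smul_right, hn', mul_zero] at h
    exact h.unique hasSum_zero

/-- Two orthonormal bases of a Hilbert space have the same cardinality. -/
theorem nonempty_equiv_of_isTotal {X Y : Set H} (hX : IsOrthonormalSet X) (hXt : IsTotal X)
    (hY : IsOrthonormalSet Y) (hYt : IsTotal Y) : Nonempty (X ≃ Y) := by
  have hfin : ∀ {A B : Set H}, IsOrthonormalSet A → IsTotal A → IsOrthonormalSet B → A.Finite →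
      B.Finite ∧ Cardinal.mk B ≤ Cardinal.mk A := by
    intro A B hA hAt hB hAf
    have : Finite A := hAf
    -- A finite-dimensional subspace with zero orthogonal complement is everything.
    have hspan : Submodule.span ℂ A = ⊤ := by
      have : FiniteDimensional ℂ (Submodule.span ℂ A) := FiniteDimensional.span_of_finite ℂ hAf
      have h := hAt.span_orthogonal
      rwa [Subtype.range_coe, Submodule.orthogonal_eq_bot_iff] at h
    have hle : Cardinal.mk B ≤ Cardinal.mk A :=
      (hB.orthonormal.linearIndependent.cardinal_le_rank).trans
        (by rw [← rank_top ℂ H, ← hspan]; exact rank_span_le A)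
    exact ⟨Cardinal.lt_aleph0_iff_finite.1 (hle.trans_lt (Cardinal.lt_aleph0_of_finite A)), hle⟩
  by_cases hXf : X.Finite
  · obtain ⟨hYf, hle⟩ := hfin hX hXt hY hXf
    exact Cardinal.eq.1 (le_antisymm (hfin hY hYt hX hYf).2 hle)
  · have hYf : ¬ Y.Finite := fun h => hXf (hfin hY hYt hX h).1
    exact Cardinal.eq.1 (le_antisymm (hX.mk_le_of_infinite hYt hYf) (hY.mk_le_of_infinite hXt hXf))

variable [CompleteSpace H]

/-! ### Construction of the multiplication from an orthogonal set -/

/-- The bounded operator that maps `w i` to `c i • v i` and vanishes on the orthogonal complement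
of the `w i`. -/
theorem _root_.Orthonormal.exists_diagonal {ι K : Type*} [NormedAddCommGroup K]
    [InnerProductSpace ℂ K] [CompleteSpace K] {v : ι → H} {w : ι → K} (hv : Orthonormal ℂ v)
    (hw : Orthonormal ℂ w) {c : ι → ℂ} {C : ℝ} (hC : 0 ≤ C) (hc : ∀ i, ‖c i‖ ≤ C) :
    ∃ T : K →L[ℂ] H, ∀ t, HasSum (fun i => (c i * inner ℂ (w i) t) • v i) (T t) := by
  classical
  let V := hv.orthogonalFamily.linearIsometry
  let W := hw.orthogonalFamily.linearIsometry
  let D : lp (fun _ : ι => ℂ) 2 →L[ℂ] lp (fun _ : ι => ℂ) 2 :=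
    lp.mapCLM 2 (fun i => c i • ContinuousLinearMap.id ℂ ℂ) hC (fun i => by
      refine (norm_smul_le _ _).trans ?_
      rw [ContinuousLinearMap.norm_id, mul_one]
      exact hc i)
  -- `W†` reads off the coefficients `⟪w i, t⟫` in `ℓ²`, `D` multiplies them by `c i`, and `V` sums
  -- them against `v i`.
  refine ⟨V.toContinuousLinearMap ∘L D ∘L adjoint W.toContinuousLinearMap, fun t => ?_⟩
  have h := hv.orthogonalFamily.hasSum_linearIsometry (D (adjoint W.toContinuousLinearMap t))
  refine (congrArg (HasSum · _) (funext fun i => ?_)).mpr h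
  have h1 : (adjoint W.toContinuousLinearMap t) i = inner ℂ (w i) t := by
    have h2 := lp.inner_single_left (𝕜 := ℂ) i (1 : ℂ) (adjoint W.toContinuousLinearMap t)
    rw [ContinuousLinearMap.adjoint_inner_right] at h2
    have h3 : W.toContinuousLinearMap (lp.single 2 i (1 : ℂ)) = w i := by
      have h4 := hw.orthogonalFamily.linearIsometry_apply_single (i := i) (1 : ℂ)
      rw [LinearIsometry.toSpanSingleton_apply, one_smul] at h4
      exact h4
    rw [h3] at h2
    simpa using h2.symm
  simp [D, h1]

/-- The multiplication with a prescribed bounded orthogonal set of group-like elements. -/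
theorem IsOrthogonalSet.exists_hasSum {X : Set H} (hX : IsOrthogonalSet X) (hb : IsBddAbove X) :
    ∃ μ : HTensor H H →L[ℂ] H, ∀ u v,
      HasSum (fun x : X =>
        ((inner ℂ (x : H) u * inner ℂ (x : H) v) / ((‖(x : H)‖ : ℂ) ^ 2)) • (x : H))
        (μ (htmul u v)) := by
  obtain ⟨C, hC, hXC⟩ := hb
  have ho := hX.orthonormal_normalize
  -- The formula sends `e_x ⊗ e_x` to `x = ‖x‖ e_x`, so the diagonal entries are the norms, and
  -- boundedness of `X` bounds the operator.
  obtain ⟨T, hT⟩ := ho.exists_diagonal (ho.htmul ho) (c := fun x : X => (‖(x : H)‖ : ℂ)) hC.le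
    (fun x => by simpa using hXC x x.2)
  refine ⟨T, fun u v => ?_⟩
  convert hT (htmul u v) using 2 with x
  have hx : (‖(x : H)‖ : ℂ) ≠ 0 := by
    simpa using fun h : (x : H) = 0 => hX.1 (h ▸ x.2)
  rw [inner_htmul, smul_smul, inner_smul_left, inner_smul_left, map_inv₀, Complex.conj_ofReal]
  congr 1
  field_simp

theorem IsOrthogonalSet.exists_isDiagonal {X : Set H} (hX : IsOrthogonalSet X)
    (hb : IsBddAbove X) : ∃ μ : HTensor H H →L[ℂ] H, IsDiagonal X μ :=
  (hX.exists_hasSum hb).imp fun _ => isDiagonal_of_hasSum hX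

/-! ### Properties of a structure read off its group-like elements -/

section Frobenius

variable {μ : HTensor H H →L[ℂ] H} (hμ : IsFrobenius μ)

include hμ

theorem IsFrobenius.hasSum (u v : H) :
    HasSum (fun x : groupLike μ =>
      ((inner ℂ (x : H) u * inner ℂ (x : H) v) / ((‖(x : H)‖ : ℂ) ^ 2)) • (x : H))
      (μ (htmul u v)) := by
  obtain ⟨ν, hν⟩ := hμ.isOrthogonalSet.exists_hasSum hμ.isBddAbove
  obtain rfl := hμ.isDiagonal.unique (isDiagonal_of_hasSum hμ.isOrthogonalSet hν)
  exact hν u v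

theorem IsFrobenius.groupLike_eq_empty_iff : groupLike μ = ∅ ↔ μ = 0 := by
  constructor
  · intro h
    refine hμ.isDiagonal.unique ⟨?_, by simp⟩
    simp [h]
  · rintro rfl
    refine Set.eq_empty_of_forall_notMem fun g hg => ?_
    have := (mem_groupLike.1 hg).2 g g
    simp [hg.1] at this

/-- The kernel of `⟪g, ·⟫` is a maximal modular ideal, with `g / ⟪g, g⟫` as identity modulo it.
Conversely, a `u` orthogonal to all group-like elements satisfies `u e = 0`, so `u = u - u e` lies
in every modular ideal. -/
theorem IsFrobenius.mem_jacobson_iff {u : H} :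
    u ∈ jacobson μ ↔ ∀ g ∈ groupLike μ, inner ℂ g u = 0 := by
  rw [jacobson, Submodule.mem_sInf]
  constructor
  · intro h g hg
    have hgg : inner ℂ g g ≠ 0 := inner_self_ne_zero.2 hg.1
    have hmul := (mem_groupLike.1 hg).2
    have hmem : ∀ x, x ∈ LinearMap.ker (innerSL ℂ g).toLinearMap ↔ inner ℂ g x = 0 := fun x => by
      simp
    refine (hmem u).1 (h _ ⟨fun a x hx => ?_, ⟨(inner ℂ g g)⁻¹ • g, fun x => ?_⟩, ?_, ?_⟩)
    · rw [hmem] at hx ⊢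
      rw [hmul, hx, mul_zero]
    · rw [hmem, inner_sub_right, hmul, inner_smul_right, inv_mul_cancel₀ hgg, mul_one, sub_self]
    · intro htop
      exact hgg ((hmem g).1 (htop ▸ Submodule.mem_top))
    · intro I' _ hle hne
      refine le_antisymm (fun y hy => by_contra fun hy0 => hne ?_) hle
      rw [hmem] at hy0
      refine Submodule.eq_top_iff'.2 fun z => ?_
      have h1 : z - (inner ℂ g z / inner ℂ g y) • y ∈ I' := hle <| by
        rw [hmem, inner_sub_right, inner_smul_right, div_mul_cancel₀ _ hy0, sub_self]
      simpa using I'.add_mem h1 (I'.smul_mem (inner ℂ g z / inner ℂ g y) hy)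
  · rintro h I ⟨_, ⟨e, he⟩, -, -⟩
    have := he u
    rwa [hμ.mul_comm, hμ.isDiagonal.mul_of_perp h, sub_zero] at this

theorem IsFrobenius.isSemisimple_iff : IsSemisimple μ ↔ IsTotal (groupLike μ) := by
  rw [IsSemisimple, Submodule.eq_bot_iff]
  exact forall_congr' fun u => by rw [hμ.mem_jacobson_iff]

theorem IsFrobenius.isRadical_iff : IsRadical μ ↔ μ = 0 := by
  rw [← hμ.groupLike_eq_empty_iff, IsRadical, Submodule.eq_top_iff']
  simp only [hμ.mem_jacobson_iff]
  constructor
  · intro h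
    exact Set.eq_empty_of_forall_notMem fun g hg => hg.1 (inner_self_eq_zero.1 (h g g hg))
  · intro h
    simp [h]

theorem IsFrobenius.mul_comul_groupLike {g : H} (hg : g ∈ groupLike μ) :
    μ (comul μ g) = ((‖g‖ : ℂ) ^ 2) • g := by
  rw [hg.2, hμ.mul_groupLike hg, inner_self_eq_norm_sq_to_K]
  rfl

theorem IsFrobenius.inner_mul_comul (h1 : ∀ g ∈ groupLike μ, ‖g‖ = 1) {g : H}
    (hg : g ∈ groupLike μ) (w : H) : inner ℂ g (μ (comul μ w)) = inner ℂ g w := by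
  rw [← ContinuousLinearMap.adjoint_inner_left, ← ContinuousLinearMap.adjoint_inner_left,
    ContinuousLinearMap.adjoint_adjoint, hμ.mul_comul_groupLike hg, h1 g hg]
  simp

theorem IsFrobenius.comul_of_perp {n : H} (hn : ∀ g ∈ groupLike μ, inner ℂ g n = 0) :
    comul μ n = 0 := by
  refine htensor_ext fun u v => ?_
  rw [inner_htmul_comul, inner_zero_right]
  exact inner_eq_zero_symm.1 (hμ.isDiagonal.inner_mul_of_perp n hn u v)

/-- On group-like elements `μ μ†` is the scalar `‖g‖²`. If all these are `1`, then `μ μ† w - w` is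
orthogonal to the group-like elements, and `μ†` kills it. -/
theorem IsFrobenius.isPartialIsometry_comul_iff :
    IsPartialIsometry (comul μ) ↔ ∀ g ∈ groupLike μ, ‖g‖ = 1 := by
  rw [IsPartialIsometry, ContinuousLinearMap.adjoint_adjoint]
  constructor
  · intro h g hg
    have h1 : comul μ (μ (comul μ g)) = comul μ g := DFunLike.congr_fun h g
    have h2 := congrArg (inner ℂ (htmul g g)) h1
    rw [hμ.mul_comul_groupLike hg, map_smul, hg.2, inner_smul_right] at h2
    have h3 : inner ℂ (htmul g g) (htmul g g) ≠ 0 := by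
      rw [inner_htmul]
      simpa using hg.1
    have h4 := mul_right_cancel₀ h3 (h2.trans (one_mul _).symm)
    exact norm_eq_one_of_sq_smul_eq hg.1 (by rw [h4, one_smul])
  · intro h1
    refine ContinuousLinearMap.ext fun w => ?_
    have h2 : comul μ (μ (comul μ w) - w) = 0 := hμ.comul_of_perp fun g hg => by
      rw [inner_sub_right, hμ.inner_mul_comul h1 hg, sub_self]
    rwa [map_sub, sub_eq_zero] at h2

theorem IsFrobenius.isSpecial_iff :
    IsSpecial μ ↔ IsOrthonormalSet (groupLike μ) ∧ IsTotal (groupLike μ) := by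
  constructor
  · intro h
    have h' : ∀ w, μ (comul μ w) = w := DFunLike.congr_fun h
    refine ⟨⟨hμ.isOrthogonalSet, fun g hg => ?_⟩, fun n hn => ?_⟩
    · exact norm_eq_one_of_sq_smul_eq hg.1 (by rw [← hμ.mul_comul_groupLike hg, h'])
    · rw [← h' n, hμ.comul_of_perp hn, map_zero]
  · rintro ⟨h1, h2⟩
    refine ContinuousLinearMap.ext fun w => ?_
    have h3 : μ (comul μ w) - w = 0 := h2 _ fun g hg => by
      rw [inner_sub_right, hμ.inner_mul_comul h1.2 hg, sub_self]
    exact sub_eq_zero.1 h3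

end Frobenius

/-! ### The bijections and unitary equivalence -/

theorem injOn_groupLike : Set.InjOn (groupLike (H := H)) {μ | IsFrobenius μ} := by
  intro μ hμ ν hν h
  refine hμ.isDiagonal.unique ?_
  rw [h]
  exact hν.isDiagonal

theorem bijOn_groupLike :
    Set.BijOn (groupLike (H := H)) {μ | IsFrobenius μ} {X | IsOrthogonalSet X ∧ IsBddAbove X} := by
  refine ⟨fun μ hμ => ⟨hμ.isOrthogonalSet, hμ.isBddAbove⟩, injOn_groupLike, ?_⟩
  rintro X ⟨hX, hb⟩
  obtain ⟨μ, hμ⟩ := hX.exists_isDiagonal hb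
  exact ⟨μ, hμ.isFrobenius hX, hμ.groupLike_eq hX⟩

/-- The bijection between Frobenius structures and bounded orthogonal sets restricts to any pair of
properties that correspond to each other. -/
theorem bijOn_groupLike_of_iff {p : (HTensor H H →L[ℂ] H) → Prop} {q : Set H → Prop}
    (h : ∀ μ, IsFrobenius μ → (p μ ↔ q (groupLike μ))) :
    Set.BijOn (groupLike (H := H)) {μ | IsFrobenius μ ∧ p μ}
      {X | (IsOrthogonalSet X ∧ IsBddAbove X) ∧ q X} := by
  refine ⟨fun μ hμ => ⟨bijOn_groupLike.mapsTo hμ.1, (h μ hμ.1).1 hμ.2⟩,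
    injOn_groupLike.mono fun μ hμ => hμ.1, ?_⟩
  rintro X ⟨hX, hq⟩
  obtain ⟨μ, hμ, rfl⟩ := bijOn_groupLike.surjOn hX
  exact ⟨μ, ⟨hμ, (h μ hμ).2 hq⟩, rfl⟩

theorem exists_isUnitaryIso {μ ν : HTensor H H →L[ℂ] H} (hμ : IsFrobenius μ) (hμs : IsSpecial μ)
    (hν : IsFrobenius ν) (hνs : IsSpecial ν) : ∃ U : H ≃ₗᵢ[ℂ] H, IsUnitaryIso μ ν U := by
  classical
  obtain ⟨hX, hXt⟩ := hμ.isSpecial_iff.1 hμs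
  obtain ⟨hY, hYt⟩ := hν.isSpecial_iff.1 hνs
  obtain ⟨e⟩ := nonempty_equiv_of_isTotal hX hXt hY hYt
  let b := HilbertBasis.mkOfOrthogonalEqBot hX.orthonormal hXt.span_orthogonal
  let b' := HilbertBasis.mkOfOrthogonalEqBot (hY.orthonormal.comp e e.injective) (by
    rw [Set.range_comp, e.range_eq_univ, Set.image_univ]
    exact hYt.span_orthogonal)
  let U : H ≃ₗᵢ[ℂ] H := b.repr.trans b'.repr.symm
  have hU : ∀ x : groupLike μ, U (x : H) = e x := fun x => by
    have h1 : b x = x := congrFun (HilbertBasis.coe_mkOfOrthogonalEqBot _ _) x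
    have h2 : b' x = e x := congrFun (HilbertBasis.coe_mkOfOrthogonalEqBot _ _) x
    rw [← h1, ← h2]
    exact (congrArg b'.repr.symm (b.repr_self x)).trans (b'.repr_symm_single x)
  refine ⟨U, ext_htmul fun u v => ?_⟩
  -- `U` carries group-like elements to group-like elements, so both sides have the same coordinates
  -- in the total set `groupLike ν`.
  have h0 : U (μ (htmul u v)) - ν (htmul (U u) (U v)) = 0 := hYt _ fun y hy => by
    obtain ⟨x, hx⟩ := e.surjective ⟨y, hy⟩
    have hxy : y = U x := by rw [hU, hx]
    rw [inner_sub_right, (mem_groupLike.1 hy).2, hxy, U.inner_map_map, U.inner_map_map,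
      U.inner_map_map, (mem_groupLike.1 x.2).2, sub_self]
  simpa using sub_eq_zero.1 h0

end

end HilbFrob

theorem mainTheorem4 (H : Type*) [NormedAddCommGroup H] [InnerProductSpace ℂ H] [CompleteSpace H] :
    Set.BijOn (HilbFrob.groupLike (H := H))
      {μ | HilbFrob.IsFrobenius μ ∧ μ ≠ 0}
      {X | X.Nonempty ∧ HilbFrob.IsOrthogonalSet X ∧ HilbFrob.IsBddAbove X} ∧
    Set.BijOn (HilbFrob.groupLike (H := H))
      {μ | HilbFrob.IsFrobenius μ ∧ HilbFrob.IsSemisimple μ}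
      {X | HilbFrob.IsOrthogonalSet X ∧ HilbFrob.IsTotal X ∧ HilbFrob.IsBddAbove X} ∧
    Set.BijOn (HilbFrob.groupLike (H := H))
      {μ | HilbFrob.IsFrobenius μ ∧ HilbFrob.comul μ ≠ 0 ∧
        HilbFrob.IsPartialIsometry (HilbFrob.comul μ)}
      {X | X.Nonempty ∧ HilbFrob.IsOrthonormalSet X} ∧
    (Set.BijOn (HilbFrob.groupLike (H := H))
        {μ | HilbFrob.IsFrobenius μ ∧ HilbFrob.IsSpecial μ}
        {X | HilbFrob.IsOrthonormalSet X ∧ HilbFrob.IsTotal X} ∧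
      ∀ μ ν : HilbFrob.HTensor H H →L[ℂ] H,
        HilbFrob.IsFrobenius μ → HilbFrob.IsSpecial μ →
        HilbFrob.IsFrobenius ν → HilbFrob.IsSpecial ν →
        ∃ U : H ≃ₗᵢ[ℂ] H, HilbFrob.IsUnitaryIso μ ν U) ∧
    ({μ : HilbFrob.HTensor H H →L[ℂ] H | HilbFrob.IsFrobenius μ ∧ HilbFrob.IsRadical μ} = {0} ∧
      ∀ μ : HilbFrob.HTensor H H →L[ℂ] H, HilbFrob.IsFrobenius μ →
        (HilbFrob.groupLike μ = ∅ ↔ μ = 0)) ∧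
    (∀ μ : HilbFrob.HTensor H H →L[ℂ] H, HilbFrob.IsFrobenius μ → ∀ u v : H,
      HasSum (fun x : HilbFrob.groupLike μ =>
          ((inner ℂ (x : H) u * inner ℂ (x : H) v) / ((‖(x : H)‖ : ℂ) ^ 2)) • (x : H))
        (μ (HilbFrob.htmul u v))) := by
  have hne : ∀ μ : HilbFrob.HTensor H H →L[ℂ] H, HilbFrob.IsFrobenius μ →
      (μ ≠ 0 ↔ (HilbFrob.groupLike μ).Nonempty) := fun μ hμ => by
    rw [Set.nonempty_iff_ne_empty, ne_eq, ne_eq, hμ.groupLike_eq_empty_iff]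
  refine ⟨?_, ?_, ?_, ⟨?_, fun μ ν hμ hμs hν hνs => HilbFrob.exists_isUnitaryIso hμ hμs hν hνs⟩,
    ⟨?_, fun μ hμ => hμ.groupLike_eq_empty_iff⟩, fun μ hμ => hμ.hasSum⟩
  · convert HilbFrob.bijOn_groupLike_of_iff (q := Set.Nonempty) hne using 1
    ext X
    exact and_comm
  · convert HilbFrob.bijOn_groupLike_of_iff (q := HilbFrob.IsTotal)
      (fun μ hμ => hμ.isSemisimple_iff) using 1
    ext X
    exact ⟨fun h => ⟨⟨h.1, h.2.2⟩, h.2.1⟩, fun h => ⟨h.1.1, h.2, h.1.2⟩⟩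
  · convert HilbFrob.bijOn_groupLike_of_iff
      (p := fun μ => HilbFrob.comul μ ≠ 0 ∧ HilbFrob.IsPartialIsometry (HilbFrob.comul μ))
      (q := fun X => X.Nonempty ∧ ∀ x ∈ X, ‖x‖ = 1)
      (fun μ hμ => and_congr ?_ hμ.isPartialIsometry_comul_iff) using 1
    · ext X
      exact ⟨fun h => ⟨⟨h.2.1, h.2.isBddAbove⟩, h.1, h.2.2⟩, fun h => ⟨h.2.1, h.1.1, h.2.2⟩⟩
    -- Taking adjoints is isometric, so `μ† ≠ 0` means `μ ≠ 0`.
    · rw [← hne μ hμ, ne_eq, ne_eq, LinearIsometryEquiv.map_eq_zero_iff]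
  · convert HilbFrob.bijOn_groupLike_of_iff
      (q := fun X => HilbFrob.IsOrthonormalSet X ∧ HilbFrob.IsTotal X)
      (fun μ hμ => hμ.isSpecial_iff) using 1
    ext X
    exact ⟨fun h => ⟨⟨h.1.1, h.1.isBddAbove⟩, h⟩, fun h => h.2⟩
  · ext μ
    refine ⟨fun h => h.1.isRadical_iff.1 h.2, ?_⟩
    rintro rfl
    have h0 : HilbFrob.IsFrobenius (0 : HilbFrob.HTensor H H →L[ℂ] H) :=
      (HilbFrob.isFrobenius_iff 0).2 (by simp)
    exact ⟨h0, h0.isRadical_iff.2 rfl⟩
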